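/- Let $\mu_0$ be a probability measure on the Borel sets of $\mathbb{R}$ with finite moments of every order, and let $\sigma^2=\int_{\mathbb{R}}x^2\,\mu_0(dx)$. Let $(\mu(\cdot,t))_{t\ge 0}$ be the solution of the Kac equation with initial datum $\mu_0$, i.e. the family of probability measures on $\mathbb{R}$ with $\mu(\cdot,0)=\mu_0$ whose characteristic functions $\varphi(\xi,t)=\int_{\mathbb{R}}e^{i\xi x}\,\mu(dx,t)$ are, for each $\xi\in\mathbb{R}$, continuous in $t$ at $t=0$ and satisfy $$\frac{\partial\varphi}{\partial t}(\xi,t)=\frac1{2\pi}\int_0^{2\pi}\varphi(\xi\cos\theta,t)\,\varphi(\xi\sin\theta,t)\,d\theta-\varphi(\xi,t)\qquad(\xi\in\mathbb{R},\ t>0).$$ Let $\gamma_\sigma$ be the Gaussian law with mean $0$ and variance $\sigma^2$ (the unit mass at $0$ if $\sigma=0$), and let $d_{\mathrm{TV}}(P;Q)=\sup_B|P(B)-Q(B)|$, the supremum being over all Borel sets $B\subseteq\mathbb{R}$. (i) If there are a constant $C>0$ and a function $\rho$ with $\rho(t)\to0$ as $t\to+\infty$ such that $$d_{\mathrm{TV}}(\mu(\cdot,t);\gamma_\sigma)\le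 C e^{-t}\rho(t)\qquad\text{for every } t\ge 0,$$ then $\mu(\cdot,t)=\gamma_\sigma$ for every $t\ge0$. (ii) Consequently, unless $\mu_0=\gamma_\sigma$, the rate $-1$ cannot be improved: if $\mu_0\ne\gamma_\sigma$, then for every $C>0$ and every function $\rho$ vanishing at $+\infty$ the bound $d_{\mathrm{TV}}(\mu(\cdot,t);\gamma_\sigma)\le Ce^{-t}\rho(t)$ fails for some $t\ge0$; in particular, for every $r>1$ and $C>0$ the bound $d_{\mathrm{TV}}(\mu(\cdot,t);\gamma_\sigma)\le Ce^{-rt}$ fails for some $t\ge 0$. -/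

import Mathlib

open MeasureTheory ProbabilityTheory Filter Topology

noncomputable section

namespace Kac

/-- Total variation distance of two laws on the line: the supremum of `|P(B) - Q(B)|` over all
Borel sets `B`. (For probability measures the supremum is over a family bounded by `1`.) -/
def tvDist (P Q : Measure ℝ) : ℝ :=
  ⨆ B : {B : Set ℝ // MeasurableSet B}, |P.real B.1 - Q.real B.1|

/-- The Gaussian law with mean zero and variance `σ ^ 2` (the unit mass at `0` if `σ = 0`). -/
def gaussianLaw (σ : ℝ) : Measure ℝ :=
  gaussianReal 0 (Real.toNNReal (σ ^ 2))

/-- The Wild product `(g₁ ⋆ g₂)(ξ) = (1 / 2π) ∫₀^{2π} g₁(ξ cos θ) g₂(ξ sin θ) dθ`. -/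
def wildProduct (g₁ g₂ : ℝ → ℂ) (ξ : ℝ) : ℂ :=
  (1 / (2 * (Real.pi : ℂ))) *
    ∫ θ in (0 : ℝ)..(2 * Real.pi), g₁ (ξ * Real.cos θ) * g₂ (ξ * Real.sin θ)

/-- The family `(μ t)`, `t ≥ 0`, of probability measures on the line is the solution of the Kac
equation in Fourier form with initial datum `μ₀`: the characteristic functions
`φ(ξ, t) = ∫ exp(i ξ x) μ(dx, t)` satisfy
`∂φ/∂t (ξ, t) = (φ(·, t) ⋆ φ(·, t))(ξ) - φ(ξ, t)` for `t > 0` and all real `ξ`, and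
`t ↦ φ(ξ, t)` starts continuously from the characteristic function of `μ₀`.
The values of `μ t` for `t < 0` play no role. -/
structure IsSolution (μ₀ : Measure ℝ) (μ : ℝ → Measure ℝ) : Prop where
  isProbabilityMeasure : ∀ t : ℝ, 0 ≤ t → IsProbabilityMeasure (μ t)
  initial : μ 0 = μ₀
  continuousWithinAt_zero : ∀ ξ : ℝ,
    ContinuousWithinAt (fun t : ℝ => charFun (μ t) ξ) (Set.Ici 0) 0
  hasDerivAt : ∀ t : ℝ, 0 < t → ∀ ξ : ℝ,
    HasDerivAt (fun s : ℝ => charFun (μ s) ξ)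
      (wildProduct (charFun (μ t)) (charFun (μ t)) ξ - charFun (μ t) ξ) t

end Kac

end

noncomputable section

namespace Kac

/-! The total variation distance controls `|φ(ξ,t) - exp(-vξ²)|`, `v = σ²/2`, up to a factor 2. So
it suffices to show that, for a non-Gaussian initial law, `exp t` times this difference fails to
tend to zero at some fixed `ξ`. Real and imaginary parts are treated separately.

Imaginary part: by symmetry of the circle the gain term has none, so `exp t * Im φ(ξ,t)` is constant
in time (`IsSolution.exp_mul_charFun_im`). The assumed decay forces `Im φ(ξ,0) = 0`.

Real part: it solves the same equation by itself. Since all moments are finite, either every even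
moment is Gaussian, and then the real part is `exp(-vξ²)`, or the initial difference is `A ξ^(2k) +
O(ξ^(2k+2))` with `A ≠ 0` (`charFun_re_eq_or_exists_leading_term`). After multiplication by `exp t`,
the leading term grows like `exp(a t)` with `a = momentGain k ≥ 0`, while the error keeps the size
`β exp(a t) ξ^(2k+2)`, with `β` independent of time (`IsRealSolution.abs_sub_gaussian_sub_le`). At a
fixed small `ξ` the difference then stays away from zero, a contradiction. -/

/-- A function on `[0, T]` is bounded in absolute value by `g` if it is so at `0` and its
derivative is bounded by that of `g`. -/
theorem abs_le_of_abs_deriv_le {f f' g g' : ℝ → ℝ} {T : ℝ}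
    (hf : ContinuousOn f (Set.Icc 0 T)) (hg : ContinuousOn g (Set.Icc 0 T))
    (hf' : ∀ t ∈ Set.Ioo 0 T, HasDerivAt f (f' t) t)
    (hg' : ∀ t ∈ Set.Ioo 0 T, HasDerivAt g (g' t) t)
    (h0 : |f 0| ≤ g 0) (h : ∀ t ∈ Set.Ioo 0 T, |f' t| ≤ g' t) :
    ∀ t ∈ Set.Icc 0 T, |f t| ≤ g t := by
  intro t ht
  have h0T : (0 : ℝ) ∈ Set.Icc 0 T := ⟨le_rfl, ht.1.trans ht.2⟩
  have key : ∀ F F' : ℝ → ℝ, ContinuousOn F (Set.Icc 0 T) →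
      (∀ t ∈ Set.Ioo 0 T, HasDerivAt F (F' t) t) → (∀ t ∈ Set.Ioo 0 T, F' t ≤ 0) →
      F 0 ≤ 0 → F t ≤ 0 := by
    intro F F' hF hF' hle hF0
    refine le_trans (antitoneOn_of_deriv_nonpos (convex_Icc 0 T) hF ?_ ?_ h0T ht ht.1) hF0
    · rw [interior_Icc]
      exact fun s hs => (hF' s hs).differentiableAt.differentiableWithinAt
    · rw [interior_Icc]
      exact fun s hs => by rw [(hF' s hs).deriv]; exact hle s hs
  rw [abs_le] at h0 ⊢
  have h1 := key (fun s => f s - g s) _ (hf.sub hg) (fun s hs => (hf' s hs).sub (hg' s hs))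
    (fun s hs => by linarith [(abs_le.1 (h s hs)).2]) (by linarith)
  have h2 := key (fun s => -f s - g s) _ (hf.neg.sub hg)
    (fun s hs => (hf' s hs).neg.sub (hg' s hs))
    (fun s hs => by linarith [(abs_le.1 (h s hs)).1]) (by linarith)
  exact ⟨by linarith, by linarith⟩

/-! ### Taylor remainders of `exp (-x)` and `cos x` -/

theorem hasDerivAt_pow_div_factorial (n : ℕ) (x : ℝ) :
    HasDerivAt (fun y : ℝ => y ^ (n + 1) / (n + 1).factorial) (x ^ n / n.factorial) x := by
  refine ((hasDerivAt_pow (n + 1) x).div_const _).congr_deriv ?_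
  rw [Nat.factorial_succ]
  push_cast
  field_simp

/-- Each remainder has minus the preceding one as derivative, so the bound follows by repeated
integration. -/
theorem abs_exp_neg_sub_taylor_le (n : ℕ) {x : ℝ} (hx : 0 ≤ x) :
    |Real.exp (-x) - ∑ j ∈ Finset.range n, (-1) ^ j * (x ^ j / j.factorial)|
      ≤ x ^ n / n.factorial := by
  induction n generalizing x with
  | zero => simp [abs_of_pos (Real.exp_pos _), hx]
  | succ n ih =>
    have hd : ∀ y : ℝ, HasDerivAt
        (fun y => Real.exp (-y) - ∑ j ∈ Finset.range (n + 1), (-1) ^ j * (y ^ j / j.factorial))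
        (-(Real.exp (-y) - ∑ j ∈ Finset.range n, (-1) ^ j * (y ^ j / j.factorial))) y := by
      intro y
      -- Splitting off the constant term `j = 0` makes the derivative of the rest an index shift.
      simp_rw [Finset.sum_range_succ' _ n, pow_zero]
      refine (((hasDerivAt_neg y).exp).fun_sub ((HasDerivAt.fun_sum fun j _ =>
        (hasDerivAt_pow_div_factorial j y).const_mul ((-1) ^ (j + 1))).add_const _)).congr_deriv ?_
      simp only [pow_succ, mul_neg, mul_one, neg_mul, Finset.sum_neg_distrib]
      ring
    refine abs_le_of_abs_deriv_le (T := x) (fun y _ => (hd y).continuousAt.continuousWithinAt)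
      (fun y _ => (hasDerivAt_pow_div_factorial n y).continuousAt.continuousWithinAt)
      (fun y _ => hd y) (fun y _ => hasDerivAt_pow_div_factorial n y) ?_ ?_ x ⟨hx, le_rfl⟩
    · simp [Finset.sum_range_succ']
    · intro y hy
      rw [abs_neg]
      exact ih hy.1.le

/-- One induction step integrates twice, passing through the remainder of the sine. -/
theorem abs_cos_sub_taylor_le (n : ℕ) (x : ℝ) :
    |Real.cos x - ∑ j ∈ Finset.range n, (-1) ^ j * (x ^ (2 * j) / (2 * j).factorial)|
      ≤ x ^ (2 * n) / (2 * n).factorial := by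
  wlog hx : 0 ≤ x generalizing x
  · have := this (-x) (by linarith)
    simpa [pow_mul] using this
  induction n generalizing x with
  | zero => simpa using Real.abs_cos_le_one x
  | succ n ih =>
    have hs : ∀ y : ℝ, HasDerivAt (fun y => Real.sin y - ∑ j ∈ Finset.range n,
        (-1) ^ j * (y ^ (2 * j + 1) / (2 * j + 1).factorial))
        (Real.cos y - ∑ j ∈ Finset.range n, (-1) ^ j * (y ^ (2 * j) / (2 * j).factorial)) y :=
      fun y => (Real.hasDerivAt_sin y).sub (HasDerivAt.fun_sum fun j _ =>
        (hasDerivAt_pow_div_factorial (2 * j) y).const_mul _)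
    have hd : ∀ y : ℝ, HasDerivAt (fun y => Real.cos y - ∑ j ∈ Finset.range (n + 1),
        (-1) ^ j * (y ^ (2 * j) / (2 * j).factorial))
        (-(Real.sin y - ∑ j ∈ Finset.range n,
        (-1) ^ j * (y ^ (2 * j + 1) / (2 * j + 1).factorial))) y := by
      intro y
      simp_rw [Finset.sum_range_succ' _ n, mul_zero, pow_zero]
      refine ((Real.hasDerivAt_cos y).fun_sub ((HasDerivAt.fun_sum fun j _ =>
        (hasDerivAt_pow_div_factorial (2 * j + 1) y).const_mul ((-1) ^ (j + 1))).add_const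
          _)).congr_deriv ?_
      simp only [pow_succ, mul_neg, mul_one, neg_mul, Finset.sum_neg_distrib]
      ring
    refine abs_le_of_abs_deriv_le (T := x) (fun y _ => (hd y).continuousAt.continuousWithinAt)
      (fun y _ => (hasDerivAt_pow_div_factorial (2 * n + 1) y).continuousAt.continuousWithinAt)
      (fun y _ => hd y) (fun y _ => hasDerivAt_pow_div_factorial (2 * n + 1) y) ?_ ?_ x ⟨hx, le_rfl⟩
    · simp [Finset.sum_range_succ']
    · intro y hy
      rw [abs_neg]
      refine abs_le_of_abs_deriv_le (T := y) (fun z _ => (hs z).continuousAt.continuousWithinAt)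
        (fun z _ => (hasDerivAt_pow_div_factorial (2 * n) z).continuousAt.continuousWithinAt)
        (fun z _ => hs z) (fun z _ => hasDerivAt_pow_div_factorial (2 * n) z) ?_ ?_ y
        ⟨hy.1.le, le_rfl⟩
      · simp
      · exact fun z hz => ih z hz.1.le

/-! ### Total variation and integrals of bounded functions -/

section TotalVariation

variable {P Q : Measure ℝ} [IsProbabilityMeasure P] [IsProbabilityMeasure Q]

theorem abs_sub_le_tvDist {B : Set ℝ} (hB : MeasurableSet B) :
    |P.real B - Q.real B| ≤ tvDist P Q := by
  refine le_ciSup (f := fun B : {B : Set ℝ // MeasurableSet B} => |P.real B.1 - Q.real B.1|)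
    ⟨1, ?_⟩ ⟨B, hB⟩
  rintro _ ⟨B, rfl⟩
  exact abs_sub_le_of_nonneg_of_le measureReal_nonneg measureReal_le_one measureReal_nonneg
    measureReal_le_one

theorem integral_sub_integral_le_tvDist {g : ℝ → ℝ} (hg : Measurable g)
    (h0 : ∀ x, 0 ≤ g x) (h1 : ∀ x, g x ≤ 1) :
    ∫ x, g x ∂P - ∫ x, g x ∂Q ≤ tvDist P Q := by
  have hint : ∀ (R : Measure ℝ) [IsFiniteMeasure R], Integrable g R := fun R _ =>
    Integrable.of_bound hg.aestronglyMeasurable 1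
      (ae_of_all _ fun x => by rw [Real.norm_eq_abs, abs_of_nonneg (h0 x)]; exact h1 x)
  -- On the Hahn set `s`, where `Q ≤ P`, test with `1 - g`; on its complement test with `g`. Adding
  -- the two gives the bound `P(s) - Q(s)`.
  obtain ⟨s, hs, hQP, hPQ⟩ := hahn_decomposition P Q
  have hle : Q.restrict s ≤ P.restrict s := by
    refine Measure.le_iff.2 fun t ht => ?_
    rw [Measure.restrict_apply ht, Measure.restrict_apply ht]
    exact hQP _ (ht.inter hs) Set.inter_subset_right
  have hle' : P.restrict sᶜ ≤ Q.restrict sᶜ := by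
    refine Measure.le_iff.2 fun t ht => ?_
    rw [Measure.restrict_apply ht, Measure.restrict_apply ht]
    exact hPQ _ (ht.inter hs.compl) Set.inter_subset_right
  have e1 : ∫ x in s, (1 - g x) ∂Q ≤ ∫ x in s, (1 - g x) ∂P :=
    integral_mono_measure hle (ae_of_all _ fun x => sub_nonneg.2 (h1 x))
      ((integrable_const 1).sub (hint _))
  have e2 : ∫ x in sᶜ, g x ∂P ≤ ∫ x in sᶜ, g x ∂Q :=
    integral_mono_measure hle' (ae_of_all _ h0) (hint _)
  rw [integral_sub (integrable_const 1) (hint _), integral_sub (integrable_const 1) (hint _)] at e1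
  simp only [integral_const, measureReal_restrict_apply_univ, smul_eq_mul, mul_one] at e1
  rw [← integral_add_compl hs (hint P), ← integral_add_compl hs (hint Q)]
  linarith [(abs_le.1 (abs_sub_le_tvDist (P := P) (Q := Q) hs)).2]

/-- The factor 2 comes from rescaling `[-1, 1]` to `[0, 1]` by `(1 + f) / 2`. -/
theorem abs_integral_sub_le_two_mul_tvDist {g : ℝ → ℝ} (hg : Measurable g)
    (h : ∀ x, |g x| ≤ 1) :
    |∫ x, g x ∂P - ∫ x, g x ∂Q| ≤ 2 * tvDist P Q := by
  have hint : ∀ (R : Measure ℝ) [IsFiniteMeasure R], Integrable g R := fun R _ =>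
    Integrable.of_bound hg.aestronglyMeasurable 1 (ae_of_all _ h)
  have key : ∀ f : ℝ → ℝ, Measurable f → (∀ x, |f x| ≤ 1) → (∀ (R : Measure ℝ)
      [IsFiniteMeasure R], Integrable f R) → ∫ x, f x ∂P - ∫ x, f x ∂Q ≤ 2 * tvDist P Q := by
    intro f hf h hint
    have := integral_sub_integral_le_tvDist (P := P) (Q := Q) (g := fun x => (1 + f x) / 2)
      (by fun_prop) (fun x => by linarith [(abs_le.1 (h x)).1])
      (fun x => by linarith [(abs_le.1 (h x)).2])
    rw [integral_div, integral_div, integral_add (integrable_const 1) (hint _),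
      integral_add (integrable_const 1) (hint _)] at this
    simp only [integral_const, probReal_univ, smul_eq_mul, mul_one] at this
    linarith
  rw [abs_le]
  have h1 := key g hg h hint
  have h2 := key (fun x => -g x) hg.neg (by simpa using h) (fun R _ => (hint R).neg)
  rw [integral_neg, integral_neg] at h2
  exact ⟨by linarith, h1⟩

end TotalVariation

/-! ### Real and imaginary parts of characteristic functions -/

section CharFun

variable {P : Measure ℝ}

theorem integrable_cexp_mul_I [IsFiniteMeasure P] (ξ : ℝ) :
    Integrable (fun x : ℝ => Complex.exp (ξ * x * Complex.I)) P := by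
  refine Integrable.of_bound (by fun_prop) 1 (ae_of_all _ fun x => ?_)
  rw [← Complex.ofReal_mul, Complex.norm_exp_ofReal_mul_I]

theorem charFun_re [IsFiniteMeasure P] (ξ : ℝ) : (charFun P ξ).re = ∫ x, Real.cos (ξ * x) ∂P := by
  rw [charFun_apply_real]
  refine (integral_re (𝕜 := ℂ) (integrable_cexp_mul_I ξ)).symm.trans ?_
  refine integral_congr_ae (ae_of_all _ fun x => ?_)
  simp only [← Complex.ofReal_mul]
  exact Complex.exp_ofReal_mul_I_re _

theorem charFun_im [IsFiniteMeasure P] (ξ : ℝ) : (charFun P ξ).im = ∫ x, Real.sin (ξ * x) ∂P := by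
  rw [charFun_apply_real]
  refine (integral_im (𝕜 := ℂ) (integrable_cexp_mul_I ξ)).symm.trans ?_
  refine integral_congr_ae (ae_of_all _ fun x => ?_)
  simp only [← Complex.ofReal_mul]
  exact Complex.exp_ofReal_mul_I_im _

theorem charFun_re_neg (ξ : ℝ) : (charFun P (-ξ)).re = (charFun P ξ).re := by
  rw [charFun_neg]; simp

theorem charFun_im_neg (ξ : ℝ) : (charFun P (-ξ)).im = -(charFun P ξ).im := by
  rw [charFun_neg]; simp

theorem abs_charFun_re_le_one [IsProbabilityMeasure P] (ξ : ℝ) : |(charFun P ξ).re| ≤ 1 :=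
  (Complex.abs_re_le_norm _).trans (norm_charFun_le_one ξ)

end CharFun

theorem charFun_gaussianLaw (σ ξ : ℝ) :
    charFun (gaussianLaw σ) ξ = (Real.exp (-(σ ^ 2 / 2 * ξ ^ 2)) : ℂ) := by
  rw [gaussianLaw, charFun_gaussianReal, Real.coe_toNNReal _ (sq_nonneg σ)]
  push_cast
  congr 1
  ring

instance isProbabilityMeasure_gaussianLaw (σ : ℝ) : IsProbabilityMeasure (gaussianLaw σ) := by
  unfold gaussianLaw; infer_instance

/-! ### Averages over the circle and the Wild product -/

/-- The mean of `f (cos θ) (sin θ)` over the circle. -/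
def circleMean (f : ℝ → ℝ → ℝ) : ℝ :=
  (2 * Real.pi)⁻¹ * ∫ θ in (0 : ℝ)..(2 * Real.pi), f (Real.cos θ) (Real.sin θ)

section CircleMean

variable {f g : ℝ → ℝ → ℝ}

theorem continuous_circle (hf : Continuous (Function.uncurry f)) :
    Continuous fun θ => f (Real.cos θ) (Real.sin θ) :=
  hf.comp (Real.continuous_cos.prodMk Real.continuous_sin)

theorem circleMean_congr (h : ∀ c s, c ^ 2 + s ^ 2 = 1 → f c s = g c s) :
    circleMean f = circleMean g := by
  unfold circleMean
  congr 2
  ext θ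
  exact h _ _ (Real.cos_sq_add_sin_sq θ)

theorem circleMean_mono (hf : Continuous (Function.uncurry f)) (hg : Continuous (Function.uncurry g))
    (h : ∀ c s, c ^ 2 + s ^ 2 = 1 → f c s ≤ g c s) : circleMean f ≤ circleMean g := by
  refine mul_le_mul_of_nonneg_left ?_ (inv_nonneg.2 Real.two_pi_pos.le)
  exact intervalIntegral.integral_mono_on Real.two_pi_pos.le
    ((continuous_circle hf).intervalIntegrable _ _) ((continuous_circle hg).intervalIntegrable _ _)
    fun θ _ => h _ _ (Real.cos_sq_add_sin_sq θ)

theorem circleMean_sub (hf : Continuous (Function.uncurry f))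
    (hg : Continuous (Function.uncurry g)) :
    circleMean (fun c s => f c s - g c s) = circleMean f - circleMean g := by
  simp only [circleMean]
  rw [intervalIntegral.integral_sub ((continuous_circle hf).intervalIntegrable _ _)
    ((continuous_circle hg).intervalIntegrable _ _), mul_sub]

theorem circleMean_add (hf : Continuous (Function.uncurry f))
    (hg : Continuous (Function.uncurry g)) :
    circleMean (fun c s => f c s + g c s) = circleMean f + circleMean g := by
  simp only [circleMean]
  rw [intervalIntegral.integral_add ((continuous_circle hf).intervalIntegrable _ _)
    ((continuous_circle hg).intervalIntegrable _ _), mul_add]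

theorem circleMean_const_mul (a : ℝ) :
    circleMean (fun c s => a * f c s) = a * circleMean f := by
  simp only [circleMean]
  rw [intervalIntegral.integral_const_mul]
  ring

theorem circleMean_const (a : ℝ) : circleMean (fun _ _ => a) = a := by
  simp only [circleMean, intervalIntegral.integral_const, sub_zero, smul_eq_mul]
  field_simp [Real.pi_ne_zero]

theorem abs_circleMean_le (hf : Continuous (Function.uncurry f))
    (hg : Continuous (Function.uncurry g))
    (h : ∀ c s, c ^ 2 + s ^ 2 = 1 → |f c s| ≤ g c s) : |circleMean f| ≤ circleMean g := by
  rw [abs_le]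
  constructor
  · have := circleMean_mono (f := fun c s => (-1) * g c s) (g := f)
      (hg.const_smul (-1 : ℝ)) hf fun c s hcs => by linarith [(abs_le.1 (h c s hcs)).1]
    rw [circleMean_const_mul] at this
    linarith
  · exact circleMean_mono hf hg fun c s hcs => (abs_le.1 (h c s hcs)).2

/-- Reflection `θ ↦ 2π - θ`. -/
theorem circleMean_eq_zero_of_odd_snd (h : ∀ c s, f c (-s) = -f c s) : circleMean f = 0 := by
  have h1 := intervalIntegral.integral_comp_sub_left
    (fun θ => f (Real.cos θ) (Real.sin θ)) (a := 0) (b := 2 * Real.pi) (2 * Real.pi)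
  simp only [Real.cos_two_pi_sub, Real.sin_two_pi_sub, h, intervalIntegral.integral_neg, sub_self,
    sub_zero] at h1
  rw [circleMean, show ∫ θ in (0 : ℝ)..(2 * Real.pi), f (Real.cos θ) (Real.sin θ) = 0 by linarith,
    mul_zero]

/-- Antipodal map `θ ↦ θ + π`, combined with periodicity. -/
theorem circleMean_eq_zero_of_odd (h : ∀ c s, f (-c) (-s) = -f c s) : circleMean f = 0 := by
  have hper : Function.Periodic (fun θ => f (Real.cos θ) (Real.sin θ)) (2 * Real.pi) := by
    intro θ
    simp [Real.cos_add_two_pi, Real.sin_add_two_pi]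
  have h1 := intervalIntegral.integral_comp_add_right
    (fun θ => f (Real.cos θ) (Real.sin θ)) (a := 0) (b := 2 * Real.pi) Real.pi
  have h2 := hper.intervalIntegral_add_eq 0 Real.pi
  simp only [Real.cos_add_pi, Real.sin_add_pi, h, intervalIntegral.integral_neg, zero_add] at h1 h2
  rw [add_comm Real.pi, ← h1] at h2
  rw [circleMean, show ∫ θ in (0 : ℝ)..(2 * Real.pi), f (Real.cos θ) (Real.sin θ) = 0 by linarith,
    mul_zero]

end CircleMean

section WildProduct

variable {φ : ℝ → ℂ}

theorem wildProduct_re_eq_circleMean (hφ : Continuous φ) (ξ : ℝ) :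
    (wildProduct φ φ ξ).re = circleMean fun c s => (φ (ξ * c) * φ (ξ * s)).re := by
  have hc : Continuous fun θ => φ (ξ * Real.cos θ) * φ (ξ * Real.sin θ) := by fun_prop
  have := Complex.reCLM.intervalIntegral_comp_comm (hc.intervalIntegrable (μ := volume) 0 (2 * Real.pi))
  simp only [Complex.reCLM_apply] at this
  rw [wildProduct, circleMean, this, ← Complex.re_ofReal_mul]
  push_cast
  rw [one_div]

theorem wildProduct_im_eq_circleMean (hφ : Continuous φ) (ξ : ℝ) :
    (wildProduct φ φ ξ).im = circleMean fun c s => (φ (ξ * c) * φ (ξ * s)).im := by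
  have hc : Continuous fun θ => φ (ξ * Real.cos θ) * φ (ξ * Real.sin θ) := by fun_prop
  have := Complex.imCLM.intervalIntegral_comp_comm (hc.intervalIntegrable (μ := volume) 0 (2 * Real.pi))
  simp only [Complex.imCLM_apply] at this
  rw [wildProduct, circleMean, this, ← Complex.im_ofReal_mul]
  push_cast
  rw [one_div]

/-- The product of the imaginary parts is odd in `s` and averages to zero; hence the real part obeys
a closed equation. -/
theorem wildProduct_re (hφ : Continuous φ)
    (him : ∀ x, (φ (-x)).im = -(φ x).im) (ξ : ℝ) :
    (wildProduct φ φ ξ).re = circleMean fun c s => (φ (ξ * c)).re * (φ (ξ * s)).re := by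
  have h0 : circleMean (fun c s => (φ (ξ * c)).im * (φ (ξ * s)).im) = 0 :=
    circleMean_eq_zero_of_odd_snd fun c s => by rw [mul_neg, him, mul_neg]
  rw [wildProduct_re_eq_circleMean hφ]
  simp only [Complex.mul_re]
  rw [circleMean_sub (by fun_prop) (by fun_prop), h0, sub_zero]

/-- The imaginary part of the product pairs an even factor with an odd one, so it changes sign under
the antipodal map. -/
theorem wildProduct_im (hφ : Continuous φ) (hre : ∀ x, (φ (-x)).re = (φ x).re)
    (him : ∀ x, (φ (-x)).im = -(φ x).im) (ξ : ℝ) : (wildProduct φ φ ξ).im = 0 := by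
  rw [wildProduct_im_eq_circleMean hφ]
  refine circleMean_eq_zero_of_odd fun c s => ?_
  simp only [Complex.mul_im, mul_neg, hre, him]
  ring

end WildProduct

/-! ### Growth bounds for real solutions -/

/-- If a bound of the form `β exp (κ t) p + c w` on the family `E t` gives the bound
`κ β exp (κ t) p + 2 c w` on its time derivative, then the bound `β p` at time `0` propagates. -/
theorem abs_le_exp_of_growth {E E' : ℝ → ℝ → ℝ} {p w : ℝ → ℝ} {β κ B T : ℝ}
    (hB0 : 0 ≤ B) (hE : ∀ ξ, ContinuousOn (fun t => E t ξ) (Set.Icc 0 T))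
    (hE' : ∀ ξ, ∀ t ∈ Set.Ioo 0 T, HasDerivAt (fun t => E t ξ) (E' t ξ) t)
    (h0 : ∀ ξ, |E 0 ξ| ≤ β * p ξ)
    (hB : ∀ t ∈ Set.Icc 0 T, ∀ ξ, |E t ξ| ≤ β * Real.exp (κ * t) * p ξ + B * w ξ)
    (hstep : ∀ t ∈ Set.Ioo 0 T, ∀ c, 0 ≤ c →
      (∀ η, |E t η| ≤ β * Real.exp (κ * t) * p η + c * w η) →
      ∀ ξ, |E' t ξ| ≤ κ * (β * Real.exp (κ * t)) * p ξ + 2 * c * w ξ) :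
    ∀ t ∈ Set.Icc 0 T, ∀ ξ, |E t ξ| ≤ β * Real.exp (κ * t) * p ξ := by
  -- Picard iteration: each integration in time turns the crude excess `B w` into the next term of
  -- the series of `B exp (2t) w`, and these terms tend to zero.
  have key : ∀ n : ℕ, ∀ t ∈ Set.Icc 0 T, ∀ ξ,
      |E t ξ| ≤ β * Real.exp (κ * t) * p ξ + B * ((2 * t) ^ n / n.factorial) * w ξ := by
    intro n
    induction n with
    | zero => simpa using hB
    | succ n ih =>
      intro t ht ξ
      have hd : ∀ t : ℝ, HasDerivAt (fun t => β * Real.exp (κ * t) * p ξ +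
          B * ((2 * t) ^ (n + 1) / (n + 1).factorial) * w ξ)
          (κ * (β * Real.exp (κ * t)) * p ξ + 2 * (B * ((2 * t) ^ n / n.factorial)) * w ξ) t := by
        intro t
        have h1 : HasDerivAt (fun t => κ * t) κ t := by simpa using (hasDerivAt_id t).const_mul κ
        have h2 : HasDerivAt (fun t : ℝ => 2 * t) 2 t := by
          simpa using (hasDerivAt_id t).const_mul (2 : ℝ)
        have h3 := (hasDerivAt_pow_div_factorial n (2 * t)).comp t h2
        exact (((h1.exp.const_mul β).mul_const (p ξ)).fun_add
          ((h3.const_mul B).mul_const (w ξ))).congr_deriv (by ring)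
      refine abs_le_of_abs_deriv_le (hE ξ) (fun s _ => (hd s).continuousAt.continuousWithinAt)
        (hE' ξ) (fun s _ => hd s) (by simpa using h0 ξ) (fun s hs => ?_) t ht
      refine hstep s hs _ ?_ (ih s ⟨hs.1.le, hs.2.le⟩) ξ
      have := hs.1
      positivity
  intro t ht ξ
  have hlim := (((FloorSemiring.tendsto_pow_div_factorial_atTop (2 * t)).const_mul B).mul_const
    (w ξ)).const_add (β * Real.exp (κ * t) * p ξ)
  rw [mul_zero, zero_mul, add_zero] at hlim
  exact ge_of_tendsto' hlim fun n => key n t ht ξ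

/-- Real-valued solutions, bounded by one, of the Kac equation in Fourier form. -/
structure IsRealSolution (R : ℝ → ℝ → ℝ) : Prop where
  continuous : ∀ t, 0 ≤ t → Continuous (R t)
  abs_le_one : ∀ t, 0 ≤ t → ∀ ξ, |R t ξ| ≤ 1
  continuousWithinAt_zero : ∀ ξ, ContinuousWithinAt (fun t => R t ξ) (Set.Ici 0) 0
  hasDerivAt : ∀ t, 0 < t → ∀ ξ, HasDerivAt (fun s => R s ξ)
    (circleMean (fun c s => R t (ξ * c) * R t (ξ * s)) - R t ξ) t

variable {R : ℝ → ℝ → ℝ}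

theorem IsRealSolution.continuousOn (hR : IsRealSolution R) (ξ T : ℝ) :
    ContinuousOn (fun t => R t ξ) (Set.Icc 0 T) := by
  intro t ht
  rcases ht.1.eq_or_lt with h | h
  · subst h
    exact (hR.continuousWithinAt_zero ξ).mono fun s hs => hs.1
  · exact (hR.hasDerivAt t h ξ).continuousAt.continuousWithinAt

theorem hasDerivAt_exp_const_mul (κ t : ℝ) :
    HasDerivAt (fun t => Real.exp (κ * t)) (κ * Real.exp (κ * t)) t := by
  have h1 : HasDerivAt (fun t => κ * t) κ t := by simpa using (hasDerivAt_id t).const_mul κ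
  exact h1.exp.congr_deriv (mul_comm _ _)

/-- A quadratic bound for `1 - R 0` propagates in time. -/
theorem IsRealSolution.abs_one_sub_le (hR : IsRealSolution R) {v : ℝ} (hv : 0 ≤ v)
    (h0 : ∀ ξ, |1 - R 0 ξ| ≤ v * ξ ^ 2) {t : ℝ} (ht : 0 ≤ t) (ξ : ℝ) :
    |1 - R t ξ| ≤ v * ξ ^ 2 := by
  -- The factor `exp t` absorbs the loss term, leaving only the gain term; `B` is the a priori bound
  -- from `|1 - R| ≤ 2` on `[0, t]`.
  have key := abs_le_exp_of_growth (E := fun t ξ => Real.exp (1 * t) * (1 - R t ξ))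
    (E' := fun t ξ => Real.exp (1 * t) *
      (1 - circleMean fun c s => R t (ξ * c) * R t (ξ * s)))
    (p := fun ξ => ξ ^ 2) (w := fun _ => 1) (β := v) (κ := 1) (B := Real.exp (1 * t) * 2)
    (T := t) (by positivity) (fun ξ => ?_) (fun ξ s hs => ?_) (fun ξ => ?_) (fun s hs ξ => ?_)
    (fun s hs c hc hE ξ => ?_) t ⟨ht, le_rfl⟩ ξ
  · rw [abs_mul, abs_of_pos (Real.exp_pos _), mul_right_comm, mul_comm (Real.exp _)] at key
    exact le_of_mul_le_mul_right key (Real.exp_pos _)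
  · exact ((Real.continuous_exp.comp (continuous_const.mul continuous_id)).continuousOn).mul
      (continuousOn_const.sub (hR.continuousOn ξ t))
  · exact ((hasDerivAt_exp_const_mul 1 s).fun_mul ((hR.hasDerivAt s hs.1 ξ).const_sub 1)).congr_deriv
      (by ring)
  · simpa using h0 ξ
  · have h1 := abs_le.1 (hR.abs_le_one s hs.1 ξ)
    have h2 : |1 - R s ξ| ≤ 2 := abs_le.2 ⟨by linarith, by linarith⟩
    rw [abs_mul, abs_of_pos (Real.exp_pos _)]
    have h3 : Real.exp (1 * s) * |1 - R s ξ| ≤ Real.exp (1 * t) * 2 :=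
      mul_le_mul (Real.exp_le_exp.2 (by linarith [hs.2])) h2 (abs_nonneg _) (Real.exp_pos _).le
    have h4 : 0 ≤ v * Real.exp (1 * s) * ξ ^ 2 := by positivity
    linarith
  · have hcont := hR.continuous s hs.1.le
    have e : Real.exp (1 * s) * (1 - circleMean fun c s' => R s (ξ * c) * R s (ξ * s')) =
        circleMean fun c s' => Real.exp (1 * s) * (1 - R s (ξ * c) * R s (ξ * s')) := by
      rw [circleMean_const_mul, circleMean_sub (by fun_prop) (by fun_prop), circleMean_const]
    rw [e, ← circleMean_const (1 * (v * Real.exp (1 * s)) * ξ ^ 2 + 2 * c * 1)]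
    refine abs_circleMean_le (by fun_prop) (by fun_prop) fun x y hxy => ?_
    have hx := hE (ξ * x)
    have hy := hE (ξ * y)
    have hone := hR.abs_le_one s hs.1.le (ξ * x)
    rw [show Real.exp (1 * s) * (1 - R s (ξ * x) * R s (ξ * y)) =
      Real.exp (1 * s) * (1 - R s (ξ * x)) + R s (ξ * x) * (Real.exp (1 * s) * (1 - R s (ξ * y)))
      by ring]
    refine (abs_add_le _ _).trans ?_
    rw [abs_mul (R s (ξ * x))]
    have h1 := mul_le_mul hone hy (abs_nonneg _) zero_le_one
    have h2 : v * Real.exp (1 * s) * (ξ * x) ^ 2 + v * Real.exp (1 * s) * (ξ * y) ^ 2 =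
      v * Real.exp (1 * s) * ξ ^ 2 := by linear_combination v * Real.exp (1 * s) * ξ ^ 2 * hxy
    linarith

theorem abs_exp_neg_sub_one_le {y : ℝ} (hy : 0 ≤ y) : |Real.exp (-y) - 1| ≤ y := by
  simpa using abs_exp_neg_sub_taylor_le 1 hy

/-- The integrand is constant on the circle: the Gaussian is a fixed point of the Wild product. -/
theorem circleMean_gaussian (v ξ : ℝ) :
    (circleMean fun c s => Real.exp (-(v * (ξ * c) ^ 2)) * Real.exp (-(v * (ξ * s) ^ 2))) =
      Real.exp (-(v * ξ ^ 2)) := by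
  rw [← circleMean_const (Real.exp (-(v * ξ ^ 2)))]
  refine circleMean_congr fun c s h => ?_
  rw [← Real.exp_add]
  congr 1
  linear_combination (-v * ξ ^ 2) * h

/-- The growth rate of the `2k`-th moment in the Kac equation with the loss term removed. -/
def momentGain (k : ℕ) : ℝ := circleMean fun c s => c ^ (2 * k) + s ^ (2 * k)

theorem momentGain_nonneg (k : ℕ) : 0 ≤ momentGain k := by
  rw [← circleMean_const 0]
  refine circleMean_mono (by fun_prop) (by fun_prop) fun c s _ => ?_
  rw [pow_mul, pow_mul]
  positivity

/-- Near `ξ = 0` the leading term of `R 0 - exp (-v ξ ^ 2)` evolves like a moment. -/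
theorem IsRealSolution.abs_sub_gaussian_sub_le (hR : IsRealSolution R) {v : ℝ} (hv : 0 ≤ v)
    (hv0 : ∀ ξ, |1 - R 0 ξ| ≤ v * ξ ^ 2) (k : ℕ) {A β : ℝ} (hAβ : |A| * v ≤ β)
    (h0 : ∀ ξ, |R 0 ξ - Real.exp (-(v * ξ ^ 2)) - A * ξ ^ (2 * k)| ≤ β * ξ ^ (2 * k + 2))
    {t : ℝ} (ht : 0 ≤ t) (ξ : ℝ) :
    |Real.exp t * (R t ξ - Real.exp (-(v * ξ ^ 2))) -
        A * Real.exp (momentGain k * t) * ξ ^ (2 * k)| ≤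
      β * Real.exp (momentGain k * t) * ξ ^ (2 * k + 2) := by
  set a := momentGain k with ha
  have hβ : 0 ≤ β := le_trans (by positivity) hAβ
  have hodd : ∀ η : ℝ, 0 ≤ η ^ (2 * k) ∧ 0 ≤ η ^ (2 * k + 2) := fun η =>
    ⟨(even_two_mul k).pow_nonneg η, by
      rw [← mul_add_one]; exact (even_two_mul _).pow_nonneg η⟩
  -- This lets the weight `w = 1 + ξ^(2k+2)` dominate the leading term in the crude bound.
  have hsmall : ∀ η : ℝ, η ^ (2 * k) ≤ 1 + η ^ (2 * k + 2) := by
    intro η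
    have := (hodd η).1
    rw [pow_add]
    rcases le_total (η ^ 2) 1 with h | h
    · have : (η ^ 2) ^ k ≤ 1 := pow_le_one₀ (sq_nonneg η) h
      rw [← pow_mul] at this
      nlinarith [sq_nonneg η]
    · nlinarith
  have key := abs_le_exp_of_growth
    (E := fun t ξ => Real.exp (1 * t) * (R t ξ - Real.exp (-(v * ξ ^ 2))) -
      A * Real.exp (a * t) * ξ ^ (2 * k))
    (E' := fun t ξ => Real.exp (1 * t) *
      ((circleMean fun c s => R t (ξ * c) * R t (ξ * s)) - Real.exp (-(v * ξ ^ 2))) -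
      A * (a * Real.exp (a * t)) * ξ ^ (2 * k))
    (p := fun ξ => ξ ^ (2 * k + 2)) (w := fun ξ => 1 + ξ ^ (2 * k + 2)) (β := β) (κ := a)
    (B := Real.exp (1 * t) * 2 + |A| * Real.exp (a * t))
    (T := t) (by positivity) (fun ξ => ?_) (fun ξ s hs => ?_) (fun ξ => ?_) (fun s hs ξ => ?_)
    (fun s hs c hc hE ξ => ?_) t ⟨ht, le_rfl⟩ ξ
  · simpa using key
  · exact (((Real.continuous_exp.comp (continuous_const.mul continuous_id)).continuousOn).mul
      ((hR.continuousOn ξ t).sub continuousOn_const)).sub (by fun_prop)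
  · exact (((hasDerivAt_exp_const_mul 1 s).fun_mul
      ((hR.hasDerivAt s hs.1 ξ).sub_const _)).fun_sub
      (((hasDerivAt_exp_const_mul a s).const_mul A).mul_const _)).congr_deriv (by ring)
  · simpa using h0 ξ
  · have h1 := abs_le.1 (hR.abs_le_one s hs.1 ξ)
    have h1' : Real.exp (-(v * ξ ^ 2)) ≤ 1 := Real.exp_le_one_iff.2 (by
      have := mul_nonneg hv (sq_nonneg ξ); linarith)
    have h1'' := Real.exp_pos (-(v * ξ ^ 2))
    have h2 : |R s ξ - Real.exp (-(v * ξ ^ 2))| ≤ 2 := abs_le.2 ⟨by linarith, by linarith⟩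
    have h3 : Real.exp (1 * s) * |R s ξ - Real.exp (-(v * ξ ^ 2))| ≤ Real.exp (1 * t) * 2 :=
      mul_le_mul (Real.exp_le_exp.2 (by linarith [hs.2])) h2 (abs_nonneg _) (Real.exp_pos _).le
    have h4 : |A| * Real.exp (a * s) * ξ ^ (2 * k) ≤
        |A| * Real.exp (a * t) * (1 + ξ ^ (2 * k + 2)) := by
      refine mul_le_mul ?_ (hsmall ξ) (hodd ξ).1 (by positivity)
      exact mul_le_mul_of_nonneg_left (Real.exp_le_exp.2
        (mul_le_mul_of_nonneg_left hs.2 (momentGain_nonneg k))) (abs_nonneg A)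
    refine (abs_sub _ _).trans ?_
    rw [abs_mul, abs_of_pos (Real.exp_pos _), abs_mul, abs_mul, abs_of_pos (Real.exp_pos _),
      abs_of_nonneg (hodd ξ).1]
    have h5 := (hodd ξ).2
    have h6 : 0 ≤ β * Real.exp (a * s) * ξ ^ (2 * k + 2) := by positivity
    have h7 : 0 ≤ Real.exp (1 * t) * 2 * ξ ^ (2 * k + 2) := by positivity
    linarith
  · have hcont := hR.continuous s hs.1.le
    set γ : ℝ → ℝ := fun ξ => Real.exp (-(v * ξ ^ 2)) with hγ
    have hγc : Continuous γ := by fun_prop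
    have hγ1 : ∀ η, |γ η| ≤ 1 := fun η => by
      rw [abs_of_pos (Real.exp_pos _)]
      exact Real.exp_le_one_iff.2 (by have := mul_nonneg hv (sq_nonneg η); linarith)
    have e : Real.exp (1 * s) * ((circleMean fun c s' => R s (ξ * c) * R s (ξ * s')) - γ ξ) -
        A * (a * Real.exp (a * s)) * ξ ^ (2 * k) =
        circleMean fun c s' => Real.exp (1 * s) * (R s (ξ * c) * R s (ξ * s') -
          γ (ξ * c) * γ (ξ * s')) -
          A * Real.exp (a * s) * ξ ^ (2 * k) * (c ^ (2 * k) + s' ^ (2 * k)) := by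
      rw [circleMean_sub (by fun_prop) (by fun_prop), circleMean_const_mul, circleMean_const_mul,
        circleMean_sub (by fun_prop) (by fun_prop), circleMean_gaussian, ← momentGain, ← ha]
      ring
    have e2 : a * (β * Real.exp (a * s)) * ξ ^ (2 * k + 2) + 2 * c * (1 + ξ ^ (2 * k + 2)) =
        circleMean fun x y => (β * Real.exp (a * s)) * ξ ^ (2 * k + 2) *
          (x ^ (2 * k) + y ^ (2 * k)) + 2 * c * (1 + ξ ^ (2 * k + 2)) := by
      rw [circleMean_add (by fun_prop) (by fun_prop), circleMean_const_mul, circleMean_const,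
        ← momentGain, ← ha]
      ring
    rw [e, e2]
    refine abs_circleMean_le (by fun_prop) (by fun_prop) fun x y hxy => ?_
    have hx := hE (ξ * x)
    have hy := hE (ξ * y)
    have hRx := hR.abs_le_one s hs.1.le (ξ * x)
    have hγy := hγ1 (ξ * y)
    have hdx : |R s (ξ * x) - 1| ≤ v * (ξ * x) ^ 2 := by
      rw [abs_sub_comm]; exact hR.abs_one_sub_le hv hv0 hs.1.le _
    have hdy : |γ (ξ * y) - 1| ≤ v * (ξ * y) ^ 2 := abs_exp_neg_sub_one_le (by positivity)
    -- Telescoping `R R' - γ γ' = R (R' - γ') + (R - γ) γ'` and subtracting the leading terms leaves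
    -- a remainder in which `R - 1` and `γ - 1` supply two extra powers of `ξ`.
    have hsplit : Real.exp (1 * s) * (R s (ξ * x) * R s (ξ * y) - γ (ξ * x) * γ (ξ * y)) -
          A * Real.exp (a * s) * ξ ^ (2 * k) * (x ^ (2 * k) + y ^ (2 * k)) =
        R s (ξ * x) * (Real.exp (1 * s) * (R s (ξ * y) - γ (ξ * y)) -
          A * Real.exp (a * s) * (ξ * y) ^ (2 * k)) +
        (Real.exp (1 * s) * (R s (ξ * x) - γ (ξ * x)) -
          A * Real.exp (a * s) * (ξ * x) ^ (2 * k)) * γ (ξ * y) +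
        A * (Real.exp (a * s) * ξ ^ (2 * k)) * ((R s (ξ * x) - 1) * y ^ (2 * k) +
          (γ (ξ * y) - 1) * x ^ (2 * k)) := by
      rw [mul_pow, mul_pow]; ring
    have hX := (hodd x).1
    have hY := (hodd y).1
    have hΞ := (hodd ξ).1
    have hΞ2 := (hodd ξ).2
    have b1 := mul_le_mul hRx hy (abs_nonneg _) zero_le_one
    have b2 := mul_le_mul hx hγy (abs_nonneg _) ((abs_nonneg _).trans hx)
    rw [← abs_mul] at b1 b2
    have b3 : |(R s (ξ * x) - 1) * y ^ (2 * k) + (γ (ξ * y) - 1) * x ^ (2 * k)| ≤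
        v * (ξ * x) ^ 2 * y ^ (2 * k) + v * (ξ * y) ^ 2 * x ^ (2 * k) := by
      refine (abs_add_le _ _).trans (add_le_add ?_ ?_)
      · rw [abs_mul, abs_of_nonneg hY]; gcongr
      · rw [abs_mul, abs_of_nonneg hX]; gcongr
    have b4 : |A * (Real.exp (a * s) * ξ ^ (2 * k)) * ((R s (ξ * x) - 1) * y ^ (2 * k) +
          (γ (ξ * y) - 1) * x ^ (2 * k))| ≤
        β * (Real.exp (a * s) * ξ ^ (2 * k + 2) * (x ^ 2 * y ^ (2 * k) + y ^ 2 * x ^ (2 * k))) := by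
      rw [abs_mul, abs_mul, abs_of_nonneg (by positivity : 0 ≤ Real.exp (a * s) * ξ ^ (2 * k))]
      calc _ ≤ |A| * (Real.exp (a * s) * ξ ^ (2 * k)) *
            (v * (ξ * x) ^ 2 * y ^ (2 * k) + v * (ξ * y) ^ 2 * x ^ (2 * k)) := by gcongr
        _ = |A| * v * (Real.exp (a * s) * ξ ^ (2 * k + 2) *
            (x ^ 2 * y ^ (2 * k) + y ^ 2 * x ^ (2 * k))) := by ring
        _ ≤ _ := by gcongr
    rw [hsplit]
    refine ((abs_add_le _ _).trans (add_le_add (abs_add_le _ _) le_rfl)).trans ?_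
    -- This yields `w(ξx) + w(ξy) ≤ 2 w(ξ)`, the factor 2 in the growth hypothesis.
    have c1 : x ^ (2 * k + 2) + y ^ (2 * k + 2) ≤ 2 := by
      have hx1 : x ^ 2 ≤ 1 := by nlinarith [sq_nonneg y]
      have hy1 : y ^ 2 ≤ 1 := by nlinarith [sq_nonneg x]
      have h1 := pow_le_one₀ (sq_nonneg x) hx1 (n := k + 1)
      have h2 := pow_le_one₀ (sq_nonneg y) hy1 (n := k + 1)
      rw [← pow_mul, mul_add_one] at h1 h2
      linarith
    have c2 := mul_le_mul_of_nonneg_left c1 (mul_nonneg hc hΞ2)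
    -- The cross terms, absorbed thanks to `|A| v ≤ β`, complete `x^(2k+2) + y^(2k+2)` to `(x² +
    -- y²)(x^(2k) + y^(2k))`. Hence the error grows at exactly the rate `momentGain k` of the
    -- leading term.
    have c3 : β * Real.exp (a * s) * (ξ * y) ^ (2 * k + 2) +
        β * Real.exp (a * s) * (ξ * x) ^ (2 * k + 2) +
        β * (Real.exp (a * s) * ξ ^ (2 * k + 2) * (x ^ 2 * y ^ (2 * k) + y ^ 2 * x ^ (2 * k))) =
        β * Real.exp (a * s) * ξ ^ (2 * k + 2) * (x ^ (2 * k) + y ^ (2 * k)) := by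
      rw [mul_pow, mul_pow, pow_add x, pow_add y]
      linear_combination β * Real.exp (a * s) * ξ ^ (2 * k + 2) * (x ^ (2 * k) + y ^ (2 * k)) * hxy
    have c4 : c * (1 + (ξ * y) ^ (2 * k + 2)) + c * (1 + (ξ * x) ^ (2 * k + 2)) =
        2 * c + c * ξ ^ (2 * k + 2) * (x ^ (2 * k + 2) + y ^ (2 * k + 2)) := by
      rw [mul_pow, mul_pow]; ring
    linarith

/-! ### Real and imaginary parts of a solution -/

section Solution

variable {μ₀ : Measure ℝ} {μ : ℝ → Measure ℝ}

theorem IsSolution.isRealSolution (hμ : IsSolution μ₀ μ) :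
    IsRealSolution fun t ξ => (charFun (μ t) ξ).re where
  continuous t ht := by
    have := hμ.isProbabilityMeasure t ht
    exact Complex.continuous_re.comp continuous_charFun
  abs_le_one t ht ξ := by
    have := hμ.isProbabilityMeasure t ht
    exact abs_charFun_re_le_one ξ
  continuousWithinAt_zero ξ :=
    Complex.continuous_re.continuousAt.comp_continuousWithinAt (hμ.continuousWithinAt_zero ξ)
  hasDerivAt t ht ξ := by
    have := hμ.isProbabilityMeasure t ht.le
    have h := Complex.reCLM.hasFDerivAt.comp_hasDerivAt t (hμ.hasDerivAt t ht ξ)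
    refine h.congr_deriv ?_
    rw [Complex.reCLM_apply, Complex.sub_re,
      wildProduct_re continuous_charFun charFun_im_neg]

/-- The imaginary part of the characteristic function decays exactly like `exp (-t)`. -/
theorem IsSolution.exp_mul_charFun_im (hμ : IsSolution μ₀ μ) {t : ℝ} (ht : 0 ≤ t) (ξ : ℝ) :
    Real.exp t * (charFun (μ t) ξ).im = (charFun μ₀ ξ).im := by
  have hd : ∀ s ∈ Set.Ioo 0 t, HasDerivAt
      (fun s => Real.exp (1 * s) * (charFun (μ s) ξ).im - (charFun μ₀ ξ).im) 0 s := by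
    intro s hs
    have := hμ.isProbabilityMeasure s hs.1.le
    have h := Complex.imCLM.hasFDerivAt.comp_hasDerivAt s (hμ.hasDerivAt s hs.1 ξ)
    refine (((hasDerivAt_exp_const_mul 1 s).fun_mul h).sub_const _).congr_deriv ?_
    simp only [Function.comp_apply, Complex.imCLM_apply, Complex.sub_im,
      wildProduct_im continuous_charFun charFun_re_neg charFun_im_neg]
    ring
  have hc : ContinuousOn (fun s => (charFun (μ s) ξ).im) (Set.Icc 0 t) := by
    intro s hs
    refine Complex.continuous_im.continuousAt.comp_continuousWithinAt ?_
    rcases hs.1.eq_or_lt with h | h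
    · subst h
      exact (hμ.continuousWithinAt_zero ξ).mono fun s hs => hs.1
    · exact (hμ.hasDerivAt s h ξ).continuousAt.continuousWithinAt
  -- Comparison with the zero function gives constancy.
  have key := abs_le_of_abs_deriv_le (T := t) (g := fun _ => 0) (g' := fun _ => 0)
    (((Real.continuous_exp.comp (continuous_const.mul continuous_id)).continuousOn.mul hc).sub
      continuousOn_const) continuousOn_const hd (fun _ _ => hasDerivAt_const _ _)
    (by simp [hμ.initial]) (by simp) t ⟨ht, le_rfl⟩
  have h0 := abs_nonpos_iff.1 key
  simp only [Pi.sub_apply, Pi.mul_apply, Function.comp_apply, one_mul, id] at h0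
  exact sub_eq_zero.1 h0

end Solution

/-! ### Moment expansion of the initial characteristic function -/

section Taylor

variable {P : Measure ℝ} [IsProbabilityMeasure P]

theorem abs_charFun_re_sub_taylor_le (hmom : ∀ n : ℕ, Integrable (fun x : ℝ => x ^ n) P)
    (n : ℕ) (ξ : ℝ) :
    |(charFun P ξ).re - ∑ j ∈ Finset.range n,
        (-1) ^ j * ((∫ x, x ^ (2 * j) ∂P) / (2 * j).factorial) * ξ ^ (2 * j)| ≤
      (∫ x, x ^ (2 * n) ∂P) / (2 * n).factorial * ξ ^ (2 * n) := by
  have hcos : Integrable (fun x => Real.cos (ξ * x)) P :=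
    Integrable.of_bound (by fun_prop) 1 (ae_of_all _ fun x => Real.abs_cos_le_one _)
  have hterm : ∀ j : ℕ, Integrable
      (fun x => (-1) ^ j * ((ξ * x) ^ (2 * j) / (2 * j).factorial)) P := by
    intro j
    simp_rw [mul_pow]
    exact (((hmom _).const_mul _).div_const _).const_mul _
  have hval : ∀ j : ℕ, ∫ x, (ξ * x) ^ (2 * j) / (2 * j).factorial ∂P =
      (∫ x, x ^ (2 * j) ∂P) / (2 * j).factorial * ξ ^ (2 * j) := by
    intro j
    simp_rw [mul_pow]
    rw [integral_div, integral_const_mul]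
    ring
  have hsum : ∑ j ∈ Finset.range n,
        (-1) ^ j * ((∫ x, x ^ (2 * j) ∂P) / (2 * j).factorial) * ξ ^ (2 * j) =
      ∫ x, ∑ j ∈ Finset.range n, (-1) ^ j * ((ξ * x) ^ (2 * j) / (2 * j).factorial) ∂P := by
    rw [integral_finsetSum _ fun j _ => hterm j]
    refine Finset.sum_congr rfl fun j _ => ?_
    rw [integral_const_mul, hval, mul_assoc]
  rw [charFun_re, hsum, ← integral_sub hcos (integrable_finsetSum _ fun j _ => hterm j), ← hval]
  refine (abs_integral_le_integral_abs).trans (integral_mono ?_ ?_ fun x => ?_)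
  · exact (hcos.sub (integrable_finsetSum _ fun j _ => hterm j)).abs
  · simp_rw [mul_pow]
    exact ((hmom _).const_mul _).div_const _
  · exact abs_cos_sub_taylor_le n _

/-- Either the even part of `P` has the characteristic function `exp (-v ξ ^ 2)`, or the
difference has a nonzero leading term at `0`. -/
theorem charFun_re_eq_or_exists_leading_term
    (hmom : ∀ n : ℕ, Integrable (fun x : ℝ => x ^ n) P) {v : ℝ} (hv : 0 ≤ v) :
    (∀ ξ, (charFun P ξ).re = Real.exp (-(v * ξ ^ 2))) ∨
      ∃ k : ℕ, ∃ A : ℝ, A ≠ 0 ∧ ∃ C : ℝ, ∀ ξ,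
        |(charFun P ξ).re - Real.exp (-(v * ξ ^ 2)) - A * ξ ^ (2 * k)| ≤ C * ξ ^ (2 * k + 2) := by
  set M : ℕ → ℝ := fun j => (∫ x, x ^ (2 * j) ∂P) / (2 * j).factorial with hM
  set G : ℕ → ℝ := fun j => v ^ j / j.factorial with hG
  have hexp : ∀ n ξ, |Real.exp (-(v * ξ ^ 2)) - ∑ j ∈ Finset.range n,
      (-1) ^ j * G j * ξ ^ (2 * j)| ≤ G n * ξ ^ (2 * n) := by
    intro n ξ
    have e : ∀ j : ℕ, (v * ξ ^ 2) ^ j / j.factorial = G j * ξ ^ (2 * j) := fun j => by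
      rw [mul_pow, ← pow_mul]; ring
    simpa only [e, ← mul_assoc] using
      abs_exp_neg_sub_taylor_le n (by positivity : 0 ≤ v * ξ ^ 2)
  have hR : ∀ n ξ, |(charFun P ξ).re - Real.exp (-(v * ξ ^ 2)) -
      ∑ j ∈ Finset.range n, (-1) ^ j * (M j - G j) * ξ ^ (2 * j)| ≤
        (M n + G n) * ξ ^ (2 * n) := by
    intro n ξ
    have h1 := abs_charFun_re_sub_taylor_le hmom n ξ
    have h2 := hexp n ξ
    have e : ∑ j ∈ Finset.range n, (-1) ^ j * (M j - G j) * ξ ^ (2 * j) =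
        ∑ j ∈ Finset.range n, (-1) ^ j * M j * ξ ^ (2 * j) -
        ∑ j ∈ Finset.range n, (-1) ^ j * G j * ξ ^ (2 * j) := by
      rw [← Finset.sum_sub_distrib]
      exact Finset.sum_congr rfl fun j _ => by ring
    rw [e, sub_sub_sub_comm]
    refine (abs_sub _ _).trans ?_
    rw [add_mul]
    exact add_le_add h1 h2
  by_cases hall : ∀ j, M j = G j
  · left
    intro ξ
    -- When all coefficients agree, the two remainders add up to twice the exponential-series term,
    -- with no separate moment-determinacy argument.
    have hlim : Tendsto (fun n : ℕ => 2 * ((v * ξ ^ 2) ^ n / n.factorial)) atTop (𝓝 (2 * 0)) :=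
      (FloorSemiring.tendsto_pow_div_factorial_atTop _).const_mul 2
    rw [mul_zero] at hlim
    have hle := ge_of_tendsto' hlim fun n => by
      have := hR n ξ
      simp only [hall, sub_self, mul_zero, zero_mul, Finset.sum_const_zero, sub_zero] at this
      refine this.trans_eq ?_
      rw [hG, mul_pow, ← pow_mul]; ring
    exact sub_eq_zero.1 (abs_nonpos_iff.1 hle)
  · right
    push Not at hall
    classical
    -- `k` is the first index of disagreement; expanding up to order `k + 1` leaves a single term.
    refine ⟨Nat.find hall, (-1) ^ Nat.find hall * (M (Nat.find hall) - G (Nat.find hall)), ?_,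
      M (Nat.find hall + 1) + G (Nat.find hall + 1), fun ξ => ?_⟩
    · exact mul_ne_zero (pow_ne_zero _ (by norm_num)) (sub_ne_zero.2 (Nat.find_spec hall))
    · have := hR (Nat.find hall + 1) ξ
      rw [Finset.sum_range_succ, Finset.sum_eq_zero fun j hj => ?_, zero_add] at this
      · exact this
      · have := Nat.find_min hall (Finset.mem_range.1 hj)
        rw [not_not.1 this, sub_self, mul_zero, zero_mul]

theorem abs_one_sub_charFun_re_le (hmom : ∀ n : ℕ, Integrable (fun x : ℝ => x ^ n) P) (ξ : ℝ) :
    |1 - (charFun P ξ).re| ≤ (∫ x, x ^ 2 ∂P) / 2 * ξ ^ 2 := by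
  rw [abs_sub_comm]
  simpa using abs_charFun_re_sub_taylor_le hmom 1 ξ

end Taylor

/-! ### Stationarity and rigidity of the Gaussian law -/

section Main

variable {μ₀ : Measure ℝ} {μ : ℝ → Measure ℝ} {σ : ℝ}

/-- The solution starting from the Gaussian law is stationary. -/
theorem IsSolution.eq_gaussianLaw (hμ : IsSolution μ₀ μ) (h0 : μ₀ = gaussianLaw σ)
    {t : ℝ} (ht : 0 ≤ t) : μ t = gaussianLaw σ := by
  have := hμ.isProbabilityMeasure t ht
  have hv : 0 ≤ σ ^ 2 / 2 := by positivity
  have hR0 : ∀ ξ, (charFun (μ 0) ξ).re = Real.exp (-(σ ^ 2 / 2 * ξ ^ 2)) := fun ξ => by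
    rw [hμ.initial, h0, charFun_gaussianLaw, Complex.ofReal_re]
  refine Measure.ext_of_charFun (funext fun ξ => ?_)
  -- With `A = β = 0` the propagated bound becomes an equality, i.e. uniqueness.
  have h1 := hμ.isRealSolution.abs_sub_gaussian_sub_le hv
    (fun ξ => by
      rw [abs_sub_comm, hR0]
      exact abs_exp_neg_sub_one_le (by positivity)) 0 (A := 0) (β := 0) (by simp)
    (fun ξ => by simp [hR0]) ht ξ
  have h2 := hμ.exp_mul_charFun_im ht ξ
  rw [h0, charFun_gaussianLaw, Complex.ofReal_im] at h2
  simp only [zero_mul, sub_zero] at h1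
  have h3 := abs_nonpos_iff.1 h1
  rw [charFun_gaussianLaw]
  apply Complex.ext
  · rw [Complex.ofReal_re]
    exact sub_eq_zero.1 ((mul_eq_zero.1 h3).resolve_left (Real.exp_pos _).ne')
  · rw [Complex.ofReal_im]
    exact (mul_eq_zero.1 h2).resolve_left (Real.exp_pos _).ne'

theorem abs_charFun_re_sub_le_tvDist {P : Measure ℝ} [IsProbabilityMeasure P] (σ ξ : ℝ) :
    |(charFun P ξ).re - Real.exp (-(σ ^ 2 / 2 * ξ ^ 2))| ≤ 2 * tvDist P (gaussianLaw σ) := by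
  rw [← Complex.ofReal_re (Real.exp _), ← charFun_gaussianLaw, charFun_re, charFun_re]
  exact abs_integral_sub_le_two_mul_tvDist (by fun_prop) fun x => Real.abs_cos_le_one _

theorem abs_charFun_im_le_tvDist {P : Measure ℝ} [IsProbabilityMeasure P] (σ ξ : ℝ) :
    |(charFun P ξ).im| ≤ 2 * tvDist P (gaussianLaw σ) := by
  have h : (charFun (gaussianLaw σ) ξ).im = 0 := by
    rw [charFun_gaussianLaw, Complex.ofReal_im]
  rw [← sub_zero (charFun P ξ).im, ← h, charFun_im, charFun_im]
  exact abs_integral_sub_le_two_mul_tvDist (by fun_prop) fun x => Real.abs_sin_le_one _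

/-- If `exp t * tvDist (μ t) (gaussianLaw σ)` is bounded by a function vanishing at infinity,
then the initial law is Gaussian. -/
theorem IsSolution.initial_eq_gaussianLaw [IsProbabilityMeasure μ₀] (hμ : IsSolution μ₀ μ)
    (hmom : ∀ n : ℕ, Integrable (fun x : ℝ => x ^ n) μ₀) (hσ : σ ^ 2 = ∫ x, x ^ 2 ∂μ₀)
    {ρ : ℝ → ℝ} (hρ : Tendsto ρ atTop (𝓝 0))
    (h : ∀ t, 0 ≤ t → tvDist (μ t) (gaussianLaw σ) ≤ Real.exp (-t) * ρ t) :
    μ₀ = gaussianLaw σ := by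
  have hv : 0 ≤ σ ^ 2 / 2 := by positivity
  have h' : ∀ t, 0 ≤ t → Real.exp t * (2 * tvDist (μ t) (gaussianLaw σ)) ≤ 2 * ρ t := by
    intro t ht
    have := mul_le_mul_of_nonneg_left (h t ht) (Real.exp_pos t).le
    rw [← mul_assoc, ← Real.exp_add, add_neg_cancel, Real.exp_zero, one_mul] at this
    linarith
  have hρ2 : Tendsto (fun t => 2 * ρ t) atTop (𝓝 0) := by simpa using hρ.const_mul 2
  have him : ∀ ξ, (charFun μ₀ ξ).im = 0 := by
    intro ξ
    refine abs_nonpos_iff.1 (ge_of_tendsto hρ2 ?_)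
    filter_upwards [eventually_ge_atTop 0] with t ht
    have := hμ.isProbabilityMeasure t ht
    rw [← hμ.exp_mul_charFun_im ht ξ, abs_mul, abs_of_pos (Real.exp_pos t)]
    exact (mul_le_mul_of_nonneg_left (abs_charFun_im_le_tvDist σ ξ) (Real.exp_pos t).le).trans
      (h' t ht)
  have hR0 : ∀ ξ, |1 - (charFun (μ 0) ξ).re| ≤ σ ^ 2 / 2 * ξ ^ 2 := by
    rw [hμ.initial, hσ]
    exact abs_one_sub_charFun_re_le hmom
  have hre : ∀ ξ, (charFun μ₀ ξ).re = Real.exp (-(σ ^ 2 / 2 * ξ ^ 2)) := by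
    rcases charFun_re_eq_or_exists_leading_term hmom hv with hre | ⟨k, A, hA, C, hC⟩
    · exact hre
    exfalso
    -- The maximum covers both the Taylor constant and the cross-term requirement `|A| v ≤ β`.
    set β := max C (|A| * (σ ^ 2 / 2)) with hβ
    have hlead := fun {t : ℝ} (ht : 0 ≤ t) => hμ.isRealSolution.abs_sub_gaussian_sub_le hv hR0 k (le_max_right C _)
      (fun ξ => by
        rw [hμ.initial]
        refine (hC ξ).trans (mul_le_mul_of_nonneg_right (le_max_left _ _) ?_)
        rw [← mul_add_one]
        exact (even_two_mul _).pow_nonneg ξ) ht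
    have hβ0 : 0 ≤ β := le_trans (by positivity) (le_max_right C _)
    have hA0 : 0 < |A| := abs_pos.2 hA
    -- A single `ξ` serves all times, since the leading term and the error carry the same factor
    -- `exp (momentGain k * t)`.
    obtain ⟨ξ, hξ, hξβ⟩ : ∃ ξ : ℝ, 0 < ξ ∧ β * ξ ^ 2 < |A| := by
      have hlim : Tendsto (fun ξ : ℝ => β * ξ ^ 2) (𝓝[>] 0) (𝓝 0) := by
        have : Continuous fun ξ : ℝ => β * ξ ^ 2 := by fun_prop
        simpa using (this.tendsto 0).mono_left nhdsWithin_le_nhds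
      obtain ⟨ξ, h1, h2⟩ := ((hlim.eventually_lt_const hA0).and self_mem_nhdsWithin).exists
      exact ⟨ξ, h2, h1⟩
    have hpos : 0 < (|A| - β * ξ ^ 2) * ξ ^ (2 * k) :=
      mul_pos (sub_pos.2 hξβ) (pow_pos hξ _)
    refine absurd (ge_of_tendsto hρ2 (b := (|A| - β * ξ ^ 2) * ξ ^ (2 * k)) ?_) (not_le.2 hpos)
    filter_upwards [eventually_ge_atTop 0] with t ht
    have := hμ.isProbabilityMeasure t ht
    have h1 := hlead ht ξ
    have h2 := (mul_le_mul_of_nonneg_left (abs_charFun_re_sub_le_tvDist (P := μ t) σ ξ)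
      (Real.exp_pos t).le).trans (h' t ht)
    rw [← abs_of_pos (Real.exp_pos t), ← abs_mul] at h2
    refine le_trans ?_ h2
    have h3 := abs_sub_abs_le_abs_sub (A * Real.exp (momentGain k * t) * ξ ^ (2 * k))
      (Real.exp t * ((charFun (μ t) ξ).re - Real.exp (-(σ ^ 2 / 2 * ξ ^ 2))))
    rw [abs_sub_comm] at h1
    rw [abs_mul, abs_mul, abs_of_pos (Real.exp_pos _), abs_of_pos (pow_pos hξ _)] at h3
    -- Nonnegativity of the rate suffices: the leading term need not grow, only not decay.
    have h4 : 1 ≤ Real.exp (momentGain k * t) :=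
      Real.one_le_exp (mul_nonneg (momentGain_nonneg k) ht)
    have h5 := mul_le_mul_of_nonneg_right h4 hpos.le
    have h6 : Real.exp (momentGain k * t) * ((|A| - β * ξ ^ 2) * ξ ^ (2 * k)) =
      |A| * Real.exp (momentGain k * t) * ξ ^ (2 * k) -
        β * Real.exp (momentGain k * t) * ξ ^ (2 * k + 2) := by ring
    linarith
  refine Measure.ext_of_charFun (funext fun ξ => ?_)
  rw [charFun_gaussianLaw]
  exact Complex.ext (by rw [hre, Complex.ofReal_re]) (by rw [him, Complex.ofReal_im])

end Main

end Kac

end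

theorem mainTheorem5 (μ₀ : Measure ℝ) [IsProbabilityMeasure μ₀]
    (hmom : ∀ n : ℕ, Integrable (fun x : ℝ => x ^ n) μ₀)
    (σ : ℝ) (hσ : σ ^ 2 = ∫ x, x ^ 2 ∂μ₀)
    (μ : ℝ → Measure ℝ) (hμ : Kac.IsSolution μ₀ μ) :
    (∀ C : ℝ, 0 < C → ∀ ρ : ℝ → ℝ, Tendsto ρ atTop (𝓝 0) →
      (∀ t : ℝ, 0 ≤ t → Kac.tvDist (μ t) (Kac.gaussianLaw σ) ≤ C * Real.exp (-t) * ρ t) →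
      ∀ t : ℝ, 0 ≤ t → μ t = Kac.gaussianLaw σ) ∧
    (μ₀ ≠ Kac.gaussianLaw σ →
      (∀ C : ℝ, 0 < C → ∀ ρ : ℝ → ℝ, Tendsto ρ atTop (𝓝 0) →
        ∃ t : ℝ, 0 ≤ t ∧ C * Real.exp (-t) * ρ t < Kac.tvDist (μ t) (Kac.gaussianLaw σ)) ∧
      (∀ r : ℝ, 1 < r → ∀ C : ℝ, 0 < C →
        ∃ t : ℝ, 0 ≤ t ∧ C * Real.exp (-(r * t)) < Kac.tvDist (μ t) (Kac.gaussianLaw σ))) := by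
  have key : ∀ C : ℝ, ∀ ρ : ℝ → ℝ, Tendsto ρ atTop (𝓝 0) →
      (∀ t : ℝ, 0 ≤ t → Kac.tvDist (μ t) (Kac.gaussianLaw σ) ≤ C * Real.exp (-t) * ρ t) →
      μ₀ = Kac.gaussianLaw σ := by
    intro C ρ hρ h
    refine hμ.initial_eq_gaussianLaw hmom hσ (ρ := fun t => C * ρ t)
      (by simpa using hρ.const_mul C) fun t ht => (h t ht).trans_eq (by ring)
  refine ⟨fun C _ ρ hρ h t ht => hμ.eq_gaussianLaw (key C ρ hρ h) ht, fun hne => ⟨?_, ?_⟩⟩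
  · intro C _ ρ hρ
    by_contra! h
    exact hne (key C ρ hρ h)
  · intro r hr C _
    by_contra! h
    -- The surplus `exp (-(r - 1) t)` plays the role of `ρ`.
    refine hne (key C (fun t => Real.exp (-((r - 1) * t))) ?_ fun t ht => (h t ht).trans_eq ?_)
    · exact Real.tendsto_exp_neg_atTop_nhds_zero.comp
        (tendsto_id.const_mul_atTop (sub_pos.2 hr))
    · rw [mul_assoc, ← Real.exp_add]
      congr 2
      ring
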